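/- The Fibonacci polynomials $F_n(x)$ and the Lucas polynomials $L_n(x)$ are the sequences of polynomials in $\mathbb{R}[x]$, indexed by all $n\in\mathbb{Z}$, with $F_0=0$, $F_1=1$, $L_0=2$, $L_1=x$, $F_{n+2}=xF_{n+1}+F_n$ and $L_{n+2}=xL_{n+1}+L_n$ for all $n\in\mathbb{Z}$. For an integer $r\ge 0$ let $L_n^{\langle r\rangle}=L_nL_{n+1}\cdots L_{n+r-1}$, with $L_n^{\langle 0\rangle}=1$. Let $m\ge 1$ and $d\ge 1$ be integers, let $s,k,n$ be any integers, and let $(d_i)_{1\le i\le m}$ and $(e_i)_{1\le i\le m}$ be sequences of integers. Then: (1) $$\det\big(\big[L_{s+k(n+i+j)}^m\big]_{0\le i,j\le m}\big)=(-1)^{(s+kn)\binom{m+1}{2}}(x^2+4)^{\binom{m+1}{2}}\prod_{i=0}^m\binom{m}{i}F_{(i+1)k}^{2(m-i)};$$ (2) $$\det\Big(\Big[\prod_{f=j+1}^m L_{s+k(n+i+d_f)}\prod_{g=1}^j L_{s+k(n+i+e_g)}\Big]_{0\le i,j\le m}\Big)=(-1)^{(s+kn)\binom{m+1}{2}+k\binom{m+1}{3}}(x^2+4)^{\binom{m+1}{2}}\prod_{l=1}^m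 F_{kl}^{m+1-l}\cdot\prod_{1\le i\le j\le m}(-1)^{kd_j}F_{k(e_i-d_j)};$$ (3) the polynomials $L_{s+k(n+i+j)}$, $0\le i,j\le m$, are nonzero, and in the field $\mathbb{R}(x)$ of rational functions $$\det\Big(\Big[\frac{1}{L_{s+k(n+i+j)}}\Big]_{0\le i,j\le m}\Big)=\frac{(-1)^{(s+kn+1)\binom{m+1}{2}}(x^2+4)^{\binom{m+1}{2}}}{\prod_{0\le i,j\le m}L_{s+k(n+i+j)}}\cdot\prod_{i=0}^m F_{k(i+1)}^{2(m-i)};$$ (4) $$\det\big(\big[L_{n+i+j}^{\langle m\rangle}\big]_{0\le i,j\le d-1}\big)=(-1)^{(n+1)\binom{d}{2}+\binom{d+1}{3}}(x^2+4)^{\binom{d}{2}}\prod_{i=1}^{d-1}\big(F_iF_{m+1-i}\big)^{d-i}\cdot\prod_{i=d-1}^{2(d-1)}L_{n+i}^{\langle m+1-d\rangle},$$ where for $d>m+1$ the last product is read as $1$ (the right-hand side is then $0$ in any case, because of the factor $F_0=0$ for $i=m+1$). -/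

import Mathlib

open Polynomial

noncomputable section

/-- The Fibonacci polynomials `F n`, indexed by all integers: `F 0 = 0`, `F 1 = 1` and
`F (n + 2) = X * F (n + 1) + F n`; for negative indices the recurrence is run backwards. -/
def fibPoly : ℤ → ℝ[X]
  | 0 => 0
  | 1 => 1
  | (n : ℕ) + 2 => X * fibPoly (n + 1) + fibPoly n
  | -((n : ℕ) + 1) => -X * fibPoly (-n) + fibPoly (-n + 1)
  termination_by n => Int.natAbs n + Int.natAbs (n - 1)

/-- The Lucas polynomials `L n`, indexed by all integers: `L 0 = 2`, `L 1 = X` and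
`L (n + 2) = X * L (n + 1) + L n`; for negative indices the recurrence is run backwards. -/
def lucasPoly : ℤ → ℝ[X]
  | 0 => 2
  | 1 => X
  | (n : ℕ) + 2 => X * lucasPoly (n + 1) + lucasPoly n
  | -((n : ℕ) + 1) => -X * lucasPoly (-n) + lucasPoly (-n + 1)
  termination_by n => Int.natAbs n + Int.natAbs (n - 1)

/-- The rising power `P_n P_{n+1} ⋯ P_{n+m-1}` (with `m` factors) of a sequence `P`. -/
def risingPow (P : ℤ → ℝ[X]) (n : ℤ) (m : ℕ) : ℝ[X] :=
  ∏ i ∈ Finset.range m, P (n + i)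

/-- The sign `(-1) ^ z` for an integer exponent `z`, as a constant polynomial. -/
def sgnPow (z : ℤ) : ℝ[X] :=
  C ((-1 : ℝ) ^ z)

end

theorem fibPoly_zero : fibPoly 0 = 0 := by rw [fibPoly]

theorem fibPoly_one : fibPoly 1 = 1 := by rw [fibPoly]

theorem fibPoly_add_two (n : ℤ) : fibPoly (n + 2) = X * fibPoly (n + 1) + fibPoly n := by
  induction n using Int.induction_on with
  | zero => have := fibPoly.eq_3 0; simpa using this
  | succ n _ => exact_mod_cast fibPoly.eq_3 (n + 1)
  | pred n _ =>
    have h := fibPoly.eq_4 n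
    rw [show (-(n : ℤ) - 1 + 2) = -n + 1 by ring, show (-(n : ℤ) - 1 + 1) = -n by ring,
      show (-(n : ℤ) - 1) = Int.negSucc n by omega, h]
    ring

theorem lucasPoly_zero : lucasPoly 0 = 2 := by rw [lucasPoly]

theorem lucasPoly_one : lucasPoly 1 = X := by rw [lucasPoly]

theorem lucasPoly_add_two (n : ℤ) :
    lucasPoly (n + 2) = X * lucasPoly (n + 1) + lucasPoly n := by
  induction n using Int.induction_on with
  | zero => have := lucasPoly.eq_3 0; simpa using this
  | succ n _ => exact_mod_cast lucasPoly.eq_3 (n + 1)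
  | pred n _ =>
    have h := lucasPoly.eq_4 n
    rw [show (-(n : ℤ) - 1 + 2) = -n + 1 by ring, show (-(n : ℤ) - 1 + 1) = -n by ring,
      show (-(n : ℤ) - 1) = Int.negSucc n by omega, h]
    ring

/-! The engine is `lucasPoly_add`: `L_{a+c}` is the linear form with coefficients `(F_{c-1}, F_c)`
evaluated at the point `(L_a, L_{a+1})`. With base indices in arithmetic progression, every entry in
(1), (2) and (4) is therefore a binary form, determined by the column, evaluated at a point
determined by the row.

For suitable products of linear forms, `det_linearFormMatrix` factors the determinant into 2×2
determinants ("wedges") of pairs of points and of pairs of forms. The d'Ocagne identities turn each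
wedge into a single Fibonacci polynomial, up to a sign and, for points, a factor `X ^ 2 + 4`.

This gives (2). Clearing denominators row by row turns (3) into a case of (2), and so does removing
a common factor from each row in (4) when `d ≤ m + 1`. For larger `d` the rank is too small. For (1)
the binomial theorem splits the matrix as Vandermonde, diagonal, Vandermonde. -/

/-! ### Signs with integer exponents -/

theorem sgnPow_zero : sgnPow 0 = 1 := by simp [sgnPow]

theorem sgnPow_one : sgnPow 1 = -1 := by simp [sgnPow]

theorem sgnPow_add (a b : ℤ) : sgnPow (a + b) = sgnPow a * sgnPow b := by
  simp [sgnPow, zpow_add₀]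

theorem sgnPow_of_even {z : ℤ} (h : Even z) : sgnPow z = 1 := by
  simp [sgnPow, h.neg_one_zpow]

theorem sgnPow_congr {a b : ℤ} (h : Even (a - b)) : sgnPow a = sgnPow b := by
  rw [← sub_add_cancel a b, sgnPow_add, sgnPow_of_even h, one_mul]

theorem sgnPow_mul_self (a : ℤ) : sgnPow a * sgnPow a = 1 := by
  rw [← sgnPow_add, sgnPow_of_even ⟨a, rfl⟩]

theorem sgnPow_pow (a : ℤ) (n : ℕ) : sgnPow a ^ n = sgnPow (a * n) := by
  induction n with
  | zero => simp [sgnPow_zero]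
  | succ n ih => rw [pow_succ, ih, ← sgnPow_add]; congr 1; push_cast; ring

theorem prod_sgnPow {ι : Type*} (s : Finset ι) (f : ι → ℤ) :
    ∏ i ∈ s, sgnPow (f i) = sgnPow (∑ i ∈ s, f i) := by
  classical
  induction s using Finset.induction_on with
  | empty => simp [sgnPow_zero]
  | insert i s hi ih => rw [Finset.prod_insert hi, Finset.sum_insert hi, ih, sgnPow_add]

/-- A two-sided sequence satisfying the recurrence is determined by its terms at `0` and `1`. -/
theorem eq_of_recurrence {G H : ℤ → ℝ[X]} (hG : ∀ n, G (n + 2) = X * G (n + 1) + G n)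
    (hH : ∀ n, H (n + 2) = X * H (n + 1) + H n) (h0 : G 0 = H 0) (h1 : G 1 = H 1) (n : ℤ) :
    G n = H n := by
  suffices h : G n = H n ∧ G (n + 1) = H (n + 1) from h.1
  induction n using Int.induction_on with
  | zero => exact ⟨h0, by simpa using h1⟩
  | succ n ih =>
    refine ⟨ih.2, ?_⟩
    rw [add_assoc, one_add_one_eq_two, hG, hH, ih.1, ih.2]
  | pred n ih =>
    have hG' := hG (-(n : ℤ) - 1)
    have hH' := hH (-(n : ℤ) - 1)
    rw [show -(n : ℤ) - 1 + 2 = -n + 1 by ring, sub_add_cancel] at hG' hH'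
    refine ⟨?_, by rw [sub_add_cancel]; exact ih.1⟩
    linear_combination hH' - hG' + ih.2 - X * ih.1

/-! ### Addition formula and d'Ocagne identities -/

theorem fibPoly_add_one (n : ℤ) : fibPoly (n + 1) = X * fibPoly n + fibPoly (n - 1) := by
  have h := fibPoly_add_two (n - 1)
  rwa [show n - 1 + 2 = n + 1 by ring, sub_add_cancel] at h

theorem fibPoly_neg_one : fibPoly (-1) = 1 := by
  have h := fibPoly_add_one 0
  simp only [zero_add, zero_sub, fibPoly_zero, fibPoly_one] at h
  linear_combination -h

/-- As functions of `c` both sides satisfy the recurrence and agree at `0` and `1`. The coefficients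
do not depend on `a`, which is what separates rows from columns in the determinants. -/
theorem lucasPoly_add (a c : ℤ) :
    lucasPoly (a + c) = fibPoly (c - 1) * lucasPoly a + fibPoly c * lucasPoly (a + 1) := by
  refine eq_of_recurrence (G := fun c => lucasPoly (a + c))
    (H := fun c => fibPoly (c - 1) * lucasPoly a + fibPoly c * lucasPoly (a + 1)) ?_ ?_ ?_ ?_ c
  · intro n
    simp only [← add_assoc]
    exact lucasPoly_add_two _
  · intro n
    have h := fibPoly_add_two (n - 1)
    rw [show n - 1 + 2 = n + 2 - 1 by ring, show n - 1 + 1 = n + 1 - 1 by ring] at h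
    simp only [h, fibPoly_add_two]
    ring
  · simp [fibPoly_neg_one, fibPoly_zero]
  · simp [fibPoly_zero, fibPoly_one]

theorem fibPoly_cassini (c : ℤ) :
    fibPoly (c - 1) * fibPoly (c + 1) - fibPoly c ^ 2 = sgnPow c := by
  induction c using Int.induction_on with
  | zero => simp [fibPoly_neg_one, fibPoly_zero, fibPoly_one, sgnPow_zero]
  | succ n ih =>
    rw [sgnPow_add, ← ih, sgnPow_one, add_sub_cancel_right, fibPoly_add_one (n + 1),
      add_sub_cancel_right, fibPoly_add_one n]
    ring
  | pred n ih =>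
    have h := fibPoly_add_one (-(n : ℤ) - 1)
    have h' := fibPoly_add_one (-(n : ℤ))
    rw [sub_add_cancel] at h ⊢
    rw [← sub_add_cancel (-(n : ℤ)) 1, sgnPow_add, sgnPow_one, sub_add_cancel] at ih
    linear_combination -ih + fibPoly (-(n : ℤ) - 1) * h' - fibPoly (-(n : ℤ)) * h

/-- The wedge of two coefficient vectors. For fixed `c` both sides satisfy the recurrence in `e -
c`; they vanish at `0`, and at `1` the claim is Cassini's identity. -/
theorem fibPoly_dOcagne (c e : ℤ) :
    fibPoly (c - 1) * fibPoly e - fibPoly (e - 1) * fibPoly c = sgnPow c * fibPoly (e - c) := by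
  have key := eq_of_recurrence
    (G := fun t => fibPoly (c - 1) * fibPoly (c + t) - fibPoly (c + t - 1) * fibPoly c)
    (H := fun t => sgnPow c * fibPoly t) ?_ ?_ ?_ ?_ (e - c)
  · simpa using key
  · intro n
    have h := fibPoly_add_two (c + n)
    have h' := fibPoly_add_two (c + n - 1)
    rw [show c + n - 1 + 2 = c + (n + 2) - 1 by ring,
      show c + n - 1 + 1 = c + (n + 1) - 1 by ring] at h'
    rw [add_assoc, add_assoc] at h
    simp only [h, h']
    ring
  · intro n
    simp only [fibPoly_add_two]
    ring
  · simp [fibPoly_zero, mul_comm]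
  · simp only [fibPoly_one, ← fibPoly_cassini, add_sub_cancel_right]
    ring

theorem fibPoly_neg (c : ℤ) : fibPoly (-c) = sgnPow (c + 1) * fibPoly c := by
  have h := fibPoly_dOcagne c 0
  simp only [fibPoly_zero, zero_sub, fibPoly_neg_one] at h
  rw [sgnPow_add, sgnPow_one]
  linear_combination (-fibPoly (-c)) * sgnPow_mul_self c - sgnPow c * h

theorem lucasPoly_eq_fibPoly (a : ℤ) : lucasPoly a = 2 * fibPoly (a - 1) + X * fibPoly a := by
  have h := lucasPoly_add 0 a
  rw [zero_add, zero_add, lucasPoly_zero, lucasPoly_one] at h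
  rw [h]; ring

/-- The wedge of two points. A fixed matrix of determinant `X ^ 2 + 4` maps `(F_{a-1}, F_a)` to
`(L_a, L_{a+1})`, so the Fibonacci wedge is scaled by that factor. -/
theorem lucasPoly_dOcagne (a b : ℤ) :
    lucasPoly a * lucasPoly (b + 1) - lucasPoly b * lucasPoly (a + 1) =
      sgnPow a * (X ^ 2 + 4) * fibPoly (b - a) := by
  have h := fibPoly_dOcagne a b
  simp only [lucasPoly_eq_fibPoly, add_sub_cancel_right, fibPoly_add_one]
  linear_combination (X ^ 2 + 4) * h

theorem lucasPoly_neg (n : ℤ) : lucasPoly (-n) = sgnPow n * lucasPoly n := by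
  have h := fibPoly_add_one n
  rw [lucasPoly_eq_fibPoly, lucasPoly_eq_fibPoly, show -n - 1 = -(n + 1) by ring, fibPoly_neg,
    fibPoly_neg, h]
  simp only [sgnPow_add, sgnPow_one]
  ring

/-- For `n ≥ 0` the value at `1` is positive by the recurrence; negative indices follow by
reflection. -/
theorem lucasPoly_ne_zero (n : ℤ) : lucasPoly n ≠ 0 := by
  have key : ∀ n : ℕ, 0 < (lucasPoly n).eval 1 ∧ 0 < (lucasPoly (n + 1)).eval 1 := by
    intro n
    induction n with
    | zero => simp [lucasPoly_zero, lucasPoly_one]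
    | succ n ih =>
      refine ⟨by exact_mod_cast ih.2, ?_⟩
      push_cast
      rw [add_assoc, one_add_one_eq_two, lucasPoly_add_two]
      simp only [eval_add, eval_mul, eval_X, one_mul]
      exact add_pos ih.2 ih.1
  have nat : ∀ n : ℕ, lucasPoly n ≠ 0 := fun n h => by simpa [h] using (key n).1
  obtain ⟨k, rfl | rfl⟩ := n.eq_nat_or_neg
  · exact nat k
  · rw [lucasPoly_neg]
    refine mul_ne_zero (fun h => ?_) (nat k)
    simpa [h] using sgnPow_mul_self k

/-! ### Determinants of products of linear forms -/

section Determinant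

variable {R : Type*} [CommRing R]

/-- A product of linear forms in two variables is a binary form. -/
theorem exists_coeff_prod_linear_forms {ι : Type*} (s : Finset ι) (a b : ι → R) :
    ∃ c : ℕ → R, ∀ x y : R, ∏ i ∈ s, (a i * x + b i * y) =
      ∑ t ∈ Finset.range (s.card + 1), y ^ t * x ^ (s.card - t) * c t := by
  classical
  induction s using Finset.induction_on with
  | empty => exact ⟨fun _ => 1, by simp⟩
  | insert i s hi ih =>
    obtain ⟨c, hc⟩ := ih
    -- The cutoffs discard `c t` above the old degree, where it is unconstrained, and the truncated
    -- index `t - 1` at `t = 0`.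
    refine ⟨fun t => (if t ≤ s.card then a i * c t else 0) +
      (if t = 0 then 0 else b i * c (t - 1)), fun x y => ?_⟩
    rw [Finset.prod_insert hi, Finset.card_insert_of_notMem hi, hc, add_mul]
    simp only [mul_add, Finset.sum_add_distrib]
    congr 1
    · rw [Finset.sum_range_succ _ (s.card + 1), if_neg (by omega), mul_zero, add_zero,
        Finset.mul_sum]
      refine Finset.sum_congr rfl fun t ht => ?_
      have : t ≤ s.card := by simpa [Nat.lt_succ_iff] using ht
      rw [if_pos this, Nat.sub_add_comm this, pow_succ]
      ring
    · rw [Finset.sum_range_succ' _ (s.card + 1), if_pos rfl, mul_zero, add_zero, Finset.mul_sum]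
      refine Finset.sum_congr rfl fun t ht => ?_
      rw [if_neg (by omega), Nat.add_sub_add_right, Nat.add_sub_cancel, pow_succ]
      ring

/-- The matrix `[∏_{j ≤ f < m} ℓ_f(p_i) ∏_{g < j} ℓ'_g(p_i)]` of values of binary forms of degree
`m` at points `p_i = (u_i, v_i)`, where `ℓ_f = a_f x + b_f y` and `ℓ'_g = a'_g x + b'_g y`. -/
def linearFormMatrix (m : ℕ) (a b a' b' : ℕ → R) (u v : Fin (m + 1) → R) :
    Matrix (Fin (m + 1)) (Fin (m + 1)) R :=
  Matrix.of fun i j => (∏ f ∈ Finset.Ico (j : ℕ) m, (a f * u i + b f * v i)) *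
    ∏ g ∈ Finset.range j, (a' g * u i + b' g * v i)

/-- Each column consists of values of one form of degree `m`, so the matrix is a projective
Vandermonde matrix times a coefficient matrix. The determinant of the latter is `c`, which does not
depend on the points. -/
theorem exists_det_linearFormMatrix_eq (m : ℕ) (a b a' b' : ℕ → R) :
    ∃ c : R, ∀ u v : Fin (m + 1) → R, (linearFormMatrix m a b a' b' u v).det =
      (∏ i, ∏ j ∈ Finset.Ioi i, (u i * v j - u j * v i)) * c := by
  have h : ∀ j : Fin (m + 1), ∃ c : ℕ → R, ∀ x y : R,
      (∏ f ∈ Finset.Ico (j : ℕ) m, (a f * x + b f * y)) *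
        ∏ g ∈ Finset.range j, (a' g * x + b' g * y) =
      ∑ t ∈ Finset.range (m + 1), y ^ t * x ^ (m - t) * c t := by
    intro j
    obtain ⟨c, hc⟩ := exists_coeff_prod_linear_forms
      ((Finset.Ico (j : ℕ) m).disjSum (Finset.range j)) (Sum.elim a a') (Sum.elim b b')
    have hcard : ((Finset.Ico (j : ℕ) m).disjSum (Finset.range j)).card = m := by
      rw [Finset.card_disjSum, Nat.card_Ico, Finset.card_range]; omega
    refine ⟨c, fun x y => ?_⟩
    rw [hcard] at hc
    rw [← hc, Finset.prod_disjSum]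
    simp
  choose c hc using h
  refine ⟨(Matrix.of fun t j : Fin (m + 1) => c j t).det, fun u v => ?_⟩
  have : linearFormMatrix m a b a' b' u v =
      Matrix.projVandermonde v u * Matrix.of fun t j : Fin (m + 1) => c j t := by
    ext i j
    rw [linearFormMatrix, Matrix.of_apply, hc, Matrix.mul_apply, ← Fin.sum_univ_eq_sum_range
      (fun t => v i ^ t * u i ^ (m - t) * c j t)]
    refine Finset.sum_congr rfl fun t _ => ?_
    rw [Matrix.projVandermonde_apply, Fin.val_rev, Matrix.of_apply, Nat.add_sub_add_right]
  rw [this, Matrix.det_mul, Matrix.det_projVandermonde]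
  congr 1
  exact Finset.prod_congr rfl fun i _ => Finset.prod_congr rfl fun j _ => by ring

theorem prod_range_triangle_succ {M : Type*} [CommMonoid M] (m : ℕ) (h : ℕ → ℕ → M) :
    ∏ j ∈ Finset.range (m + 1), ∏ i ∈ Finset.range (j + 1), h i j =
      (∏ j ∈ Finset.range (m + 1), h 0 j) *
        ∏ j ∈ Finset.range m, ∏ i ∈ Finset.range (j + 1), h (i + 1) (j + 1) := by
  simp only [Finset.prod_range_succ' (fun i => h i _), Finset.prod_mul_distrib]
  rw [mul_comm, Finset.prod_range_succ' (fun j => ∏ i ∈ Finset.range j, h (i + 1) j)]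
  simp

/-- A homogeneous form of Krattenthaler's determinant. -/
theorem det_linearFormMatrix [IsDomain R] [Infinite R] (m : ℕ) (a b a' b' : ℕ → R)
    (u v : Fin (m + 1) → R) :
    (linearFormMatrix m a b a' b' u v).det =
      (∏ i, ∏ j ∈ Finset.Ioi i, (u i * v j - u j * v i)) *
        ∏ j ∈ Finset.range m, ∏ i ∈ Finset.range (j + 1), (a j * b' i - a' i * b j) := by
  induction m generalizing a b a' b' with
  | zero => simp [linearFormMatrix]
  | succ m ih =>
    rw [prod_range_triangle_succ m fun i j => a j * b' i - a' i * b j]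
    -- If `ℓ'_0` is the zero form, its root gives no usable point; but then the last column
    -- vanishes.
    by_cases hz : a' 0 = 0 ∧ b' 0 = 0
    · rw [Finset.prod_eq_zero (i := 0) (s := Finset.range (m + 1)) (by simp) (by simp [hz]),
        zero_mul, mul_zero]
      refine Matrix.det_eq_zero_of_column_eq_zero (Fin.last (m + 1)) fun i => ?_
      rw [linearFormMatrix, Matrix.of_apply,
        Finset.prod_eq_zero (i := 0) (s := Finset.range _) (by simp) (by simp [hz]), mul_zero]
    obtain ⟨c, hc⟩ := exists_det_linearFormMatrix_eq (m + 1) a b a' b'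
    rw [hc]
    congr 1
    -- Since `c` is independent of the points, it can be found at convenient ones: the root `(b'_0,
    -- -a'_0)` of `ℓ'_0`, followed by distinct points `(1, q_i)` off that root. Infinitude of `R`
    -- supplies the `q_i`, and the Vandermonde product is then nonzero.
    have hfin : {t : R | a' 0 + b' 0 * t = 0}.Finite := by
      refine Set.Subsingleton.finite fun t ht t' ht' => ?_
      simp only [Set.mem_ofPred_eq] at ht ht'
      have hb : b' 0 ≠ 0 := fun hb => hz ⟨by simpa [hb] using ht, hb⟩
      exact mul_left_cancel₀ hb (by linear_combination ht - ht')
    let t : ℕ ↪ _ := hfin.infinite_compl.natEmbedding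
    have ht : ∀ i, a' 0 + b' 0 * (t i : R) ≠ 0 := fun i => (t i).2
    let q : Fin (m + 1) → R := fun i => t i
    have hq : ∀ i, a' 0 * 1 + b' 0 * q i ≠ 0 := fun i => by simpa using ht i
    have hV : (∏ i, ∏ j ∈ Finset.Ioi i, ((1 : R) * q j - 1 * q i)) ≠ 0 := by
      refine Finset.prod_ne_zero_iff.2 fun i _ => Finset.prod_ne_zero_iff.2 fun j hj h => ?_
      have h' : q j = q i := by linear_combination h
      have := t.injective (Subtype.ext h')
      exact (Finset.mem_Ioi.1 hj).ne' (Fin.ext this)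
    have hcons : (∏ i : Fin (m + 1 + 1), ∏ j ∈ Finset.Ioi i,
        ((Fin.cons (b' 0) fun _ => 1 : Fin (m + 1 + 1) → R) i *
          (Fin.cons (-a' 0) q : Fin (m + 1 + 1) → R) j -
        (Fin.cons (b' 0) fun _ => 1 : Fin (m + 1 + 1) → R) j *
          (Fin.cons (-a' 0) q : Fin (m + 1 + 1) → R) i)) =
        (∏ j, (a' 0 * 1 + b' 0 * q j)) * ∏ i, ∏ j ∈ Finset.Ioi i, (1 * q j - 1 * q i) := by
      rw [Fin.prod_univ_succ]
      simp only [Fin.prod_Ioi_zero, Fin.prod_Ioi_succ, Fin.cons_zero, Fin.cons_succ]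
      congr 1
      exact Finset.prod_congr rfl fun _ _ => by ring
    have hdet := hc (Fin.cons (b' 0) fun _ => 1) (Fin.cons (-a' 0) q)
    -- Every column after the first contains `ℓ'_0`, so only the first entry of row zero survives.
    -- The remaining minor has the factor `ℓ'_0(1, q_i)` in row `i`; without it, it is the same
    -- matrix one size smaller with all forms shifted by one.
    rw [Matrix.det_succ_row_zero, Fin.sum_univ_succ, Finset.sum_eq_zero, add_zero] at hdet
    · have hsub : (linearFormMatrix (m + 1) a b a' b' (Fin.cons (b' 0) fun _ => 1)
          (Fin.cons (-a' 0) q)).submatrix Fin.succ (Fin.succAbove 0) =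
          Matrix.of fun i j => (a' 0 * 1 + b' 0 * q i) *
            linearFormMatrix m (fun f => a (f + 1)) (fun f => b (f + 1)) (fun f => a' (f + 1))
              (fun f => b' (f + 1)) (fun _ => 1) q i j := by
        ext i j
        simp only [linearFormMatrix, Matrix.submatrix_apply, Matrix.of_apply, Fin.cons_succ,
          Fin.zero_succAbove, Fin.val_succ, Finset.prod_range_succ']
        rw [← Finset.prod_Ico_add' (fun f => a f * 1 + b f * q i) j m 1]
        ring
      rw [hsub, Matrix.det_mul_column, ih, hcons] at hdet
      simp only [Fin.cons_zero, linearFormMatrix, Matrix.of_apply, Fin.val_zero, pow_zero, one_mul, Finset.range_zero,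
        Finset.prod_empty, mul_one, ← Finset.range_eq_Ico] at hdet
      have e2 : ∏ j ∈ Finset.range (m + 1), (a j * b' 0 + b j * -a' 0) =
          ∏ j ∈ Finset.range (m + 1), (a j * b' 0 - a' 0 * b j) :=
        Finset.prod_congr rfl fun _ _ => by ring
      have hP : ∏ j, (a' 0 * 1 + b' 0 * q j) ≠ 0 := Finset.prod_ne_zero_iff.2 fun i _ => hq i
      simp only [e2, mul_one, one_mul] at hdet hP hV
      refine mul_left_cancel₀ (mul_ne_zero hP hV) ?_
      linear_combination -hdet
    · intro j _
      rw [linearFormMatrix, Matrix.of_apply,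
        Finset.prod_eq_zero (i := 0) (s := Finset.range _) (by simp)]
      · simp
      · simp only [Fin.cons_zero]; ring

end Determinant

/-! ### Triangular products and Vandermonde products of Lucas and Fibonacci points -/

theorem prod_Ioi_eq_prod_range {M : Type*} [CommMonoid M] (m : ℕ) (h : ℕ → ℕ → M) :
    ∏ i : Fin (m + 1), ∏ j ∈ Finset.Ioi i, h i j =
      ∏ j ∈ Finset.range (m + 1), ∏ i ∈ Finset.range j, h i j := by
  induction m with
  | zero => simp
  | succ m ih =>
    rw [Finset.prod_range_succ, ← ih, Fin.prod_univ_castSucc, ← Fin.prod_univ_eq_prod_range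
      (fun i => h i (m + 1)), ← Finset.prod_mul_distrib]
    have hlast : Finset.Ioi (Fin.last (m + 1)) = ∅ := by ext i; simp [Fin.le_last]
    rw [hlast, Finset.prod_empty, mul_one]
    refine Finset.prod_congr rfl fun i _ => ?_
    have hi : Finset.Ioi i.castSucc =
        insert (Fin.last (m + 1)) ((Finset.Ioi i).map Fin.castSuccEmb) := by
      ext j
      refine Fin.lastCases ?_ (fun j => ?_) j
      · simp [Fin.castSucc_lt_last]
      · simp [Fin.le_last]
    rw [hi, Finset.prod_insert (by simp), Finset.prod_map, mul_comm]
    rfl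

theorem prod_range_triangle_sub {M : Type*} [CommMonoid M] (m : ℕ) (G : ℕ → M) :
    ∏ j ∈ Finset.range (m + 1), ∏ i ∈ Finset.range j, G (j - i) =
      ∏ l ∈ Finset.range m, G (l + 1) ^ (m - l) := by
  induction m with
  | zero => simp
  | succ m ih =>
    rw [Finset.prod_range_succ, ih]
    have h : ∏ i ∈ Finset.range (m + 1), G (m + 1 - i) = ∏ l ∈ Finset.range (m + 1), G (l + 1) := by
      rw [← Finset.prod_range_reflect]
      refine Finset.prod_congr rfl fun i hi => ?_
      have := Finset.mem_range.1 hi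
      congr 1; omega
    rw [h, Finset.prod_range_succ (fun l => G (l + 1)), Finset.prod_range_succ, ← mul_assoc,
      ← Finset.prod_mul_distrib]
    congr 1
    · refine Finset.prod_congr rfl fun l hl => ?_
      have := Finset.mem_range.1 hl
      rw [← pow_succ]; congr 1; omega
    · simp

theorem sum_range_eq_choose_two (m : ℕ) : ∑ j ∈ Finset.range m, j = m.choose 2 := by
  rw [Finset.sum_range_id, Nat.choose_two_right]

theorem sum_range_choose_two (m : ℕ) : ∑ j ∈ Finset.range m, j.choose 2 = m.choose 3 := by
  induction m with
  | zero => rfl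
  | succ m ih => rw [Finset.sum_range_succ, ih, Nat.choose_succ_succ' m 2, add_comm]

theorem sum_range_triangle (m : ℕ) (c k : ℤ) :
    ∑ j ∈ Finset.range m, ∑ i ∈ Finset.range j, (c + k * i) =
      c * m.choose 2 + k * m.choose 3 := by
  have h2 : ∀ m : ℕ, ∑ j ∈ Finset.range m, (j : ℤ) = m.choose 2 := fun m => by
    rw [← sum_range_eq_choose_two, Nat.cast_sum]
  have h3 : ∑ j ∈ Finset.range m, (j.choose 2 : ℤ) = m.choose 3 := by
    rw [← sum_range_choose_two, Nat.cast_sum]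
  simp only [Finset.sum_add_distrib, ← Finset.mul_sum, Finset.sum_const, Finset.card_range,
    nsmul_eq_mul, ← Finset.sum_mul, h2, h3]
  ring

/-- The Vandermonde product of the points `(L_{c + k i}, L_{c + k i + 1})`. -/
theorem prod_lucasPoly_wedge (m : ℕ) (c k : ℤ) :
    ∏ i : Fin (m + 1), ∏ j ∈ Finset.Ioi i,
      (lucasPoly (c + k * (i : ℕ)) * lucasPoly (c + k * (j : ℕ) + 1) -
        lucasPoly (c + k * (j : ℕ)) * lucasPoly (c + k * (i : ℕ) + 1)) =
      sgnPow (c * (m + 1).choose 2 + k * (m + 1).choose 3) * (X ^ 2 + 4) ^ (m + 1).choose 2 *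
        ∏ l ∈ Finset.range m, fibPoly (k * (l + 1 : ℕ)) ^ (m - l) := by
  rw [prod_Ioi_eq_prod_range m fun i j => lucasPoly (c + k * i) * lucasPoly (c + k * j + 1) -
        lucasPoly (c + k * j) * lucasPoly (c + k * i + 1),
    ← prod_range_triangle_sub m fun l => fibPoly (k * l)]
  have h : ∀ j ∈ Finset.range (m + 1), ∀ i ∈ Finset.range j,
      lucasPoly (c + k * i) * lucasPoly (c + k * j + 1) -
        lucasPoly (c + k * j) * lucasPoly (c + k * i + 1) =
      sgnPow (c + k * i) * (X ^ 2 + 4) * fibPoly (k * (j - i : ℕ)) := by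
    intro j _ i hi
    rw [lucasPoly_dOcagne, Nat.cast_sub (Finset.mem_range.1 hi).le]
    congr 2; ring
  rw [Finset.prod_congr rfl fun j hj => Finset.prod_congr rfl (h j hj)]
  simp only [Finset.prod_mul_distrib, Finset.prod_const, Finset.card_range, prod_sgnPow,
    sum_range_triangle]
  rw [Finset.prod_pow_eq_pow_sum, sum_range_eq_choose_two]

/-- The wedge of the coefficient forms. -/
theorem prod_fibPoly_wedge (m : ℕ) (k : ℤ) :
    ∏ i : Fin (m + 1), ∏ j ∈ Finset.Ioi i,
      (fibPoly (k * (i : ℕ) - 1) * fibPoly (k * (j : ℕ)) -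
        fibPoly (k * (j : ℕ) - 1) * fibPoly (k * (i : ℕ))) =
      sgnPow (k * (m + 1).choose 3) * ∏ l ∈ Finset.range m, fibPoly (k * (l + 1 : ℕ)) ^ (m - l) := by
  rw [prod_Ioi_eq_prod_range m fun i j => fibPoly (k * i - 1) * fibPoly (k * j) -
        fibPoly (k * j - 1) * fibPoly (k * i),
    ← prod_range_triangle_sub m fun l => fibPoly (k * l)]
  have h : ∀ j ∈ Finset.range (m + 1), ∀ i ∈ Finset.range j,
      fibPoly (k * i - 1) * fibPoly (k * j) - fibPoly (k * j - 1) * fibPoly (k * i) =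
      sgnPow (k * i) * fibPoly (k * (j - i : ℕ)) := by
    intro j _ i hi
    rw [fibPoly_dOcagne, Nat.cast_sub (Finset.mem_range.1 hi).le]
    congr 2; ring
  rw [Finset.prod_congr rfl fun j hj => Finset.prod_congr rfl (h j hj)]
  have hs := sum_range_triangle (m + 1) 0 k
  simp only [zero_mul, zero_add] at hs
  simp only [Finset.prod_mul_distrib, prod_sgnPow, hs]

/-! ### The four determinants -/

/-- Expanding the `m`-th power of the addition formula gives the factorization `hM`. Each
Vandermonde factor contributes the sign with exponent `k * (m + 1).choose 3`, and the two cancel. -/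
theorem det_lucasPoly_pow (m : ℕ) (c k : ℤ) :
    (Matrix.of fun i j : Fin (m + 1) => lucasPoly (c + k * (i : ℕ) + k * (j : ℕ)) ^ m).det =
      sgnPow (c * (m + 1).choose 2) * (X ^ 2 + 4) ^ (m + 1).choose 2 *
        ∏ i ∈ Finset.range (m + 1),
          ((m.choose i : ℝ[X]) * fibPoly ((i + 1) * k) ^ (2 * (m - i))) := by
  have hM : (Matrix.of fun i j : Fin (m + 1) => lucasPoly (c + k * (i : ℕ) + k * (j : ℕ)) ^ m) =
      Matrix.projVandermonde (fun i : Fin (m + 1) => lucasPoly (c + k * (i : ℕ) + 1))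
        (fun i => lucasPoly (c + k * (i : ℕ))) *
      Matrix.diagonal (fun t : Fin (m + 1) => (m.choose t : ℝ[X])) *
      (Matrix.projVandermonde (fun j : Fin (m + 1) => fibPoly (k * (j : ℕ)))
        (fun j => fibPoly (k * (j : ℕ) - 1))).transpose := by
    ext1 i j
    rw [Matrix.mul_apply, Matrix.of_apply, lucasPoly_add, add_comm, add_pow,
      ← Fin.sum_univ_eq_sum_range (fun t => (fibPoly (k * (j : ℕ)) *
        lucasPoly (c + k * (i : ℕ) + 1)) ^ t * (fibPoly (k * (j : ℕ) - 1) *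
        lucasPoly (c + k * (i : ℕ))) ^ (m - t) * (m.choose t : ℝ[X]))]
    refine Finset.sum_congr rfl fun t _ => ?_
    rw [Matrix.mul_diagonal, Matrix.transpose_apply, Matrix.projVandermonde_apply,
      Matrix.projVandermonde_apply, Fin.val_rev, Nat.add_sub_add_right, mul_pow, mul_pow]
    ring
  rw [hM, Matrix.det_mul, Matrix.det_mul, Matrix.det_transpose, Matrix.det_diagonal,
    Matrix.det_projVandermonde, Matrix.det_projVandermonde]
  have h1 := prod_lucasPoly_wedge m c k
  have h2 := prod_fibPoly_wedge m k
  simp only [mul_comm (lucasPoly (c + k * _))] at h1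
  simp only [mul_comm (fibPoly (k * _ - 1))] at h2
  rw [h1, h2, Fin.prod_univ_eq_prod_range (fun t => (m.choose t : ℝ[X])), Finset.prod_mul_distrib,
    Finset.prod_range_succ (fun i => fibPoly _ ^ _)]
  simp only [pow_mul', pow_two, Finset.prod_mul_distrib, Nat.sub_self, pow_zero, mul_one, sgnPow_add]
  push_cast
  simp only [mul_comm k (_ + 1)]
  linear_combination (sgnPow (c * ↑((m + 1).choose 2)) * (X ^ 2 + 4) ^ (m + 1).choose 2 *
    (∏ x ∈ Finset.range m, fibPoly ((↑x + 1) * k) ^ (m - x)) ^ 2 *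
    ∏ i ∈ Finset.range (m + 1), (m.choose i : ℝ[X])) * sgnPow_mul_self (k * (m + 1).choose 3)

theorem det_lucasPoly_prod (m : ℕ) (c k : ℤ) (δ ε : ℕ → ℤ) :
    (Matrix.of fun i j : Fin (m + 1) =>
        (∏ f ∈ Finset.Ico (j : ℕ) m, lucasPoly (c + k * (i : ℕ) + k * δ f)) *
          ∏ g ∈ Finset.range j, lucasPoly (c + k * (i : ℕ) + k * ε g)).det =
      sgnPow (c * (m + 1).choose 2 + k * (m + 1).choose 3) * (X ^ 2 + 4) ^ (m + 1).choose 2 *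
        (∏ l ∈ Finset.range m, fibPoly (k * (l + 1 : ℕ)) ^ (m - l)) *
        ∏ j ∈ Finset.range m, ∏ i ∈ Finset.range (j + 1),
          (sgnPow (k * δ j) * fibPoly (k * (ε i - δ j))) := by
  have h := det_linearFormMatrix m (fun f => fibPoly (k * δ f - 1)) (fun f => fibPoly (k * δ f))
    (fun g => fibPoly (k * ε g - 1)) (fun g => fibPoly (k * ε g))
    (fun i : Fin (m + 1) => lucasPoly (c + k * (i : ℕ)))
    (fun i => lucasPoly (c + k * (i : ℕ) + 1))
  simp only [linearFormMatrix, ← lucasPoly_add, fibPoly_dOcagne, ← mul_sub] at h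
  rw [h, prod_lucasPoly_wedge]

theorem prod_range_triangle_shift {M : Type*} [CommMonoid M] (m : ℕ) (h : ℕ → ℕ → M) :
    ∏ j ∈ Finset.range m, ∏ i ∈ Finset.range (j + 1), h i (j + 1) =
      ∏ j ∈ Finset.range (m + 1), ∏ i ∈ Finset.range j, h i j := by
  simp [Finset.prod_range_succ' (fun j => ∏ i ∈ Finset.range j, h i j)]

theorem prod_Icc_succ_eq_prod_Ico {M : Type*} [CommMonoid M] (a m : ℕ) (h : ℕ → M) :
    ∏ f ∈ Finset.Icc (a + 1) m, h f = ∏ f ∈ Finset.Ico a m, h (f + 1) := by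
  rw [Finset.prod_Ico_add']
  rfl

theorem prod_Icc_one_eq_prod_range {M : Type*} [CommMonoid M] (m : ℕ) (h : ℕ → M) :
    ∏ f ∈ Finset.Icc 1 m, h f = ∏ f ∈ Finset.range m, h (f + 1) := by
  rw [Finset.range_eq_Ico, ← prod_Icc_succ_eq_prod_Ico 0 m h]

/-- These shifts make the entry in column `j` the product of all `L_{c+ki+kt}`, `0 ≤ t ≤ m`, with `t
= j` omitted: the reciprocal matrix after clearing denominators. -/
theorem det_lucasPoly_prod_of_succ (m : ℕ) (c k : ℤ) :
    (Matrix.of fun i j : Fin (m + 1) =>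
        (∏ f ∈ Finset.Ico (j : ℕ) m, lucasPoly (c + k * (i : ℕ) + k * (f + 1 : ℕ))) *
          ∏ g ∈ Finset.range j, lucasPoly (c + k * (i : ℕ) + k * g)).det =
      sgnPow ((c + 1) * (m + 1).choose 2) * (X ^ 2 + 4) ^ (m + 1).choose 2 *
        ∏ i ∈ Finset.range (m + 1), fibPoly (k * (i + 1)) ^ (2 * (m - i)) := by
  rw [det_lucasPoly_prod m c k (fun f => (f + 1 : ℕ)) fun g => g]
  rw [prod_range_triangle_shift m fun i j => sgnPow (k * j) * fibPoly (k * (i - j))]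
  have h : ∀ j ∈ Finset.range (m + 1), ∀ i ∈ Finset.range j,
      sgnPow (k * j) * fibPoly (k * (i - j)) =
        sgnPow (1 + k * i) * fibPoly (k * (j - i : ℕ)) := by
    intro j _ i hi
    -- The index `k * (i - j)` is reflected; the extra `1` in the sign exponent is what turns `c`
    -- into `c + 1`.
    rw [Nat.cast_sub (Finset.mem_range.1 hi).le, ← neg_sub, mul_neg, fibPoly_neg, ← mul_assoc,
      ← sgnPow_add]
    congr 1
    exact sgnPow_congr ⟨k * j - k * i, by ring⟩
  rw [Finset.prod_congr rfl fun j hj => Finset.prod_congr rfl (h j hj)]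
  simp only [Finset.prod_mul_distrib, prod_sgnPow, sum_range_triangle]
  rw [prod_range_triangle_sub m fun l => fibPoly (k * l),
    Finset.prod_range_succ (fun i => fibPoly _ ^ _)]
  simp only [pow_mul', pow_two, Finset.prod_mul_distrib, Nat.sub_self, pow_zero, mul_one,
    add_mul, sgnPow_add, one_mul]
  push_cast
  linear_combination (sgnPow (c * ↑((m + 1).choose 2)) * (X ^ 2 + 4) ^ (m + 1).choose 2 *
    sgnPow ↑((m + 1).choose 2) *
    (∏ x ∈ Finset.range m, fibPoly (k * (↑x + 1)) ^ (m - x)) ^ 2) *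
    sgnPow_mul_self (k * (m + 1).choose 3)

theorem det_inv_lucasPoly {K : Type*} [Field K] {φ : ℝ[X] →+* K} (hφ : Function.Injective φ)
    (m : ℕ) (c k : ℤ) :
    (Matrix.of fun i j : Fin (m + 1) =>
        1 / φ (lucasPoly (c + k * (i : ℕ) + k * (j : ℕ)))).det =
      φ
          (sgnPow ((c + 1) * (m + 1).choose 2) * (X ^ 2 + 4) ^ (m + 1).choose 2) /
        φ
          (∏ i : Fin (m + 1), ∏ j : Fin (m + 1),
            lucasPoly (c + k * (i : ℕ) + k * (j : ℕ))) *
        φ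
          (∏ i ∈ Finset.range (m + 1), fibPoly (k * (i + 1)) ^ (2 * (m - i))) := by
  have hne : ∀ a : ℤ, φ (lucasPoly a) ≠ 0 := fun a =>
    (map_ne_zero_iff φ hφ).2 (lucasPoly_ne_zero a)
  have h := congrArg φ (det_lucasPoly_prod_of_succ m c k)
  rw [RingHom.map_det, map_mul] at h
  have hM : φ.mapMatrix (Matrix.of fun i j : Fin (m + 1) =>
        (∏ f ∈ Finset.Ico (j : ℕ) m, lucasPoly (c + k * (i : ℕ) + k * (f + 1 : ℕ))) *
          ∏ g ∈ Finset.range j, lucasPoly (c + k * (i : ℕ) + k * g)) =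
      Matrix.of fun i j : Fin (m + 1) => (∏ t : Fin (m + 1),
          φ (lucasPoly (c + k * (i : ℕ) + k * (t : ℕ)))) *
        (Matrix.of fun i j : Fin (m + 1) =>
          1 / φ (lucasPoly (c + k * (i : ℕ) + k * (j : ℕ)))) i j := by
    ext1 i j
    have hj : (j : ℕ) + 1 ≤ m + 1 := j.2
    rw [RingHom.mapMatrix_apply, Matrix.map_apply, Matrix.of_apply, Matrix.of_apply,
      Matrix.of_apply, mul_one_div, eq_div_iff (hne _), ← map_prod, ← map_mul,
      Fin.prod_univ_eq_prod_range (fun t => lucasPoly (c + k * (i : ℕ) + k * t)),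
      ← Finset.prod_range_mul_prod_Ico _ hj, Finset.prod_range_succ,
      ← Finset.prod_Ico_add' (fun t : ℕ => lucasPoly (c + k * (i : ℕ) + k * t))]
    exact congrArg φ (by ring)
  rw [hM, Matrix.det_mul_column] at h
  rw [div_mul_eq_mul_div, ← h, eq_div_iff]
  · simp only [map_prod]; ring
  · simp only [map_prod]
    exact Finset.prod_ne_zero_iff.2 fun i _ => Finset.prod_ne_zero_iff.2 fun j _ => hne _

/-- Forms of degree `m` have only `m + 1` coefficients, so the rank is below `d`. The coefficient
matrix is padded to a square one by zero rows, of which row `m + 1` is one. -/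
theorem det_risingPow_eq_zero (m d : ℕ) (n : ℤ) (hd : m + 1 < d) :
    (Matrix.of fun i j : Fin d => risingPow lucasPoly (n + (i : ℕ) + (j : ℕ)) m).det = 0 := by
  choose c hc using fun j : ℕ => exists_coeff_prod_linear_forms (Finset.range m)
    (fun f => fibPoly (j + f - 1)) (fun f => fibPoly (j + f))
  have hM : (Matrix.of fun i j : Fin d => risingPow lucasPoly (n + (i : ℕ) + (j : ℕ)) m) =
      (Matrix.of fun i t : Fin d =>
        lucasPoly (n + (i : ℕ) + 1) ^ (t : ℕ) * lucasPoly (n + (i : ℕ)) ^ (m - t)) *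
      Matrix.of fun t j : Fin d => if (t : ℕ) < m + 1 then c j t else 0 := by
    ext1 i j
    simp only [Matrix.mul_apply, Matrix.of_apply, mul_ite, mul_zero]
    rw [Fin.sum_univ_eq_sum_range (fun t : ℕ => if t < m + 1 then
      lucasPoly (n + (i : ℕ) + 1) ^ t * lucasPoly (n + (i : ℕ)) ^ (m - t) * c j t else 0),
      ← Finset.sum_filter]
    have hf : (Finset.range d).filter (· < m + 1) = Finset.range (m + 1) := by
      ext t; simp; omega
    have := hc j (lucasPoly (n + (i : ℕ))) (lucasPoly (n + (i : ℕ) + 1))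
    rw [Finset.card_range] at this
    rw [hf, ← this, risingPow]
    refine Finset.prod_congr rfl fun f _ => ?_
    rw [add_assoc _ (j : ℤ), lucasPoly_add]
  rw [hM, Matrix.det_mul]
  exact mul_eq_zero_of_right _ (Matrix.det_eq_zero_of_row_eq_zero ⟨m + 1, hd⟩ fun j => by simp)

/-- In row `i` the offsets `[j, j + m + r)` contain `[m, m + r)` for every `j ≤ m`, so that block is
a row factor. What is left, `[j, m)` and `[m + r, m + r + j)`, is the product pattern with `δ f = f`
and `ε g = m + r + g`. -/
theorem det_risingPow (m r : ℕ) (n : ℤ) :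
    (Matrix.of fun i j : Fin (m + 1) =>
        risingPow lucasPoly (n + (i : ℕ) + (j : ℕ)) (m + r)).det =
      sgnPow ((n + 1) * (m + 1).choose 2 + (m + 2).choose 3) * (X ^ 2 + 4) ^ (m + 1).choose 2 *
        (∏ i ∈ Finset.Icc 1 m,
          (fibPoly i * fibPoly ((m + r : ℕ) + 1 - i)) ^ (m + 1 - i)) *
        ∏ i ∈ Finset.Icc m (2 * m), risingPow lucasPoly (n + i) r := by
  have h := det_lucasPoly_prod m n 1 (fun f => f) fun g => (m + r + g : ℕ)
  have hM : (Matrix.of fun i j : Fin (m + 1) =>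
        risingPow lucasPoly (n + (i : ℕ) + (j : ℕ)) (m + r)) =
      Matrix.of fun i j : Fin (m + 1) => risingPow lucasPoly (n + (i : ℕ) + m) r *
        (Matrix.of fun i j : Fin (m + 1) =>
        (∏ f ∈ Finset.Ico (j : ℕ) m, lucasPoly (n + 1 * (i : ℕ) + 1 * f)) *
          ∏ g ∈ Finset.range j, lucasPoly (n + 1 * (i : ℕ) + 1 * (m + r + g : ℕ))) i j := by
    ext1 i j
    have hj : (j : ℕ) ≤ m := Nat.lt_succ_iff.1 j.2
    have e1 : risingPow lucasPoly (n + (i : ℕ) + (j : ℕ)) (m + r) =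
        ∏ f ∈ Finset.Ico (j : ℕ) (j + (m + r)), lucasPoly (n + (i : ℕ) + f) := by
      rw [Finset.prod_Ico_eq_prod_range, Nat.add_sub_cancel_left, risingPow]
      exact Finset.prod_congr rfl fun f _ => by push_cast; rw [add_assoc]
    have e2 : risingPow lucasPoly (n + (i : ℕ) + m) r =
        ∏ f ∈ Finset.Ico m (m + r), lucasPoly (n + (i : ℕ) + f) := by
      rw [Finset.prod_Ico_eq_prod_range, Nat.add_sub_cancel_left, risingPow]
      exact Finset.prod_congr rfl fun f _ => by push_cast; rw [add_assoc]
    have e3 : ∏ g ∈ Finset.range j, lucasPoly (n + (i : ℕ) + (m + r + g : ℕ)) =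
        ∏ f ∈ Finset.Ico (m + r) (j + (m + r)), lucasPoly (n + (i : ℕ) + f) := by
      rw [Finset.prod_Ico_eq_prod_range, Nat.add_sub_cancel]
    simp only [Matrix.of_apply, one_mul]
    rw [e1, e2, e3, ← mul_assoc, mul_comm (∏ f ∈ Finset.Ico m (m + r), _),
      Finset.prod_Ico_consecutive _ hj (Nat.le_add_right m r),
      Finset.prod_Ico_consecutive _ (by omega) (by omega)]
  rw [hM, Matrix.det_mul_column, h]
  -- For each `j` the sign occurs `j + 1` times, and `j * (j + 1)` is even. The index `m + r + i -
  -- j` depends only on the difference `(j + 1) - i`.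
  have hT : ∏ j ∈ Finset.range m, ∏ i ∈ Finset.range (j + 1),
      (sgnPow (1 * (j : ℤ)) * fibPoly (1 * (((m + r + i : ℕ) : ℤ) - j))) =
      ∏ l ∈ Finset.range m, fibPoly ((m + r : ℕ) + 1 - (l + 1 : ℕ)) ^ (m - l) := by
    rw [← prod_range_triangle_sub m fun l => fibPoly ((m + r : ℕ) + 1 - l),
      ← prod_range_triangle_shift m fun i j => fibPoly ((m + r : ℕ) + 1 - (j - i : ℕ))]
    refine Finset.prod_congr rfl fun j _ => ?_
    rw [Finset.prod_mul_distrib, Finset.prod_const, Finset.card_range, sgnPow_pow,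
      sgnPow_of_even (by rw [one_mul]; exact_mod_cast Nat.even_mul_succ_self j), one_mul]
    refine Finset.prod_congr rfl fun i hi => ?_
    rw [Nat.cast_sub (Finset.mem_range.1 hi).le]
    congr 1; push_cast; ring
  have hR : ∏ i ∈ Finset.Icc m (2 * m), risingPow lucasPoly (n + i) r =
      ∏ i : Fin (m + 1), risingPow lucasPoly (n + (i : ℕ) + m) r := by
    rw [Fin.prod_univ_eq_prod_range (fun i => risingPow lucasPoly (n + i + m) r),
      show Finset.Icc m (2 * m) = Finset.Ico m (2 * m + 1) from rfl, Finset.prod_Ico_eq_prod_range,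
      show 2 * m + 1 - m = m + 1 by omega]
    refine Finset.prod_congr rfl fun i _ => ?_
    congr 1; push_cast; ring
  have hs : sgnPow ((n + 1) * (m + 1).choose 2 + (m + 2).choose 3) =
      sgnPow (n * (m + 1).choose 2 + 1 * (m + 1).choose 3) := by
    -- Pascal's rule makes the two exponents differ by twice `(m + 1).choose 2`.
    rw [Nat.choose_succ_succ' (m + 1) 2]
    exact sgnPow_congr ⟨(m + 1).choose 2, by push_cast; ring⟩
  rw [hT, hR, hs, prod_Icc_one_eq_prod_range]
  simp only [one_mul, Nat.add_sub_add_right, mul_pow, Finset.prod_mul_distrib]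
  ring

theorem corollary3 (m d : ℕ) (hm : 1 ≤ m) (hd : 1 ≤ d) (s k n : ℤ) (δ ε : ℕ → ℤ) :
    -- powers
    (Matrix.of fun i j : Fin (m + 1) =>
        lucasPoly (s + k * (n + (i : ℕ) + (j : ℕ))) ^ m).det
      = sgnPow ((s + k * n) * (m + 1).choose 2) * (X ^ 2 + 4) ^ (m + 1).choose 2 *
        ∏ i ∈ Finset.range (m + 1),
          ((m.choose i : ℝ[X]) * fibPoly ((i + 1) * k) ^ (2 * (m - i))) ∧
    -- products
    (Matrix.of fun i j : Fin (m + 1) =>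
        (∏ f ∈ Finset.Icc ((j : ℕ) + 1) m, lucasPoly (s + k * (n + (i : ℕ) + δ f))) *
          ∏ g ∈ Finset.Icc 1 (j : ℕ), lucasPoly (s + k * (n + (i : ℕ) + ε g))).det
      = sgnPow ((s + k * n) * (m + 1).choose 2 + k * (m + 1).choose 3) *
        (X ^ 2 + 4) ^ (m + 1).choose 2 *
        (∏ l ∈ Finset.Icc 1 m, fibPoly (k * l) ^ (m + 1 - l)) *
        ∏ j ∈ Finset.Icc 1 m, ∏ i ∈ Finset.Icc 1 j,
          (sgnPow (k * δ j) * fibPoly (k * (ε i - δ j))) ∧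
    -- reciprocals, in the field of rational functions; the denominators do not vanish
    ((∀ i j : Fin (m + 1), lucasPoly (s + k * (n + (i : ℕ) + (j : ℕ))) ≠ 0) ∧
      (Matrix.of fun i j : Fin (m + 1) =>
          1 / algebraMap ℝ[X] (RatFunc ℝ) (lucasPoly (s + k * (n + (i : ℕ) + (j : ℕ))))).det
        = algebraMap ℝ[X] (RatFunc ℝ)
            (sgnPow ((s + k * n + 1) * (m + 1).choose 2) * (X ^ 2 + 4) ^ (m + 1).choose 2) /
          algebraMap ℝ[X] (RatFunc ℝ)
            (∏ i : Fin (m + 1), ∏ j : Fin (m + 1),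
              lucasPoly (s + k * (n + (i : ℕ) + (j : ℕ)))) *
          algebraMap ℝ[X] (RatFunc ℝ)
            (∏ i ∈ Finset.range (m + 1), fibPoly (k * (i + 1)) ^ (2 * (m - i)))) ∧
    -- rising powers; for `d > m + 1` the factor `fibPoly 0 = 0` occurs on the right-hand side,
    -- so that the value of the last product does not matter there
    (Matrix.of fun i j : Fin d =>
        risingPow lucasPoly (n + (i : ℕ) + (j : ℕ)) m).det
      = sgnPow ((n + 1) * d.choose 2 + (d + 1).choose 3) * (X ^ 2 + 4) ^ d.choose 2 *
        (∏ i ∈ Finset.Icc 1 (d - 1),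
          (fibPoly i * fibPoly ((m : ℤ) + 1 - i)) ^ (d - i)) *
        ∏ i ∈ Finset.Icc (d - 1) (2 * (d - 1)),
          risingPow lucasPoly (n + i) (m + 1 - d) := by
  have e : ∀ a b : ℤ, s + k * (n + a + b) = s + k * n + k * a + k * b := fun a b => by ring
  simp only [e]
  refine ⟨det_lucasPoly_pow m _ k, ?_, ⟨fun i j => lucasPoly_ne_zero _, det_inv_lucasPoly (RatFunc.algebraMap_injective ℝ) m _ k⟩,
    ?_⟩
  · have h := det_lucasPoly_prod m (s + k * n) k (fun f => δ (f + 1)) fun g => ε (g + 1)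
    simp only [prod_Icc_succ_eq_prod_Ico, ← Finset.range_eq_Ico, Nat.add_sub_add_right]
    exact h
  · rcases le_or_gt d (m + 1) with hdm | hdm
    · obtain ⟨d, rfl⟩ := Nat.exists_eq_add_of_le' hd
      obtain ⟨r, rfl⟩ := Nat.exists_eq_add_of_le (Nat.succ_le_succ_iff.1 hdm)
      rw [det_risingPow, Nat.add_sub_cancel, show d + r + 1 - (d + 1) = r by omega]
    -- The index `m + 1` lies in the range, and its factor `F_0` has the positive exponent `d - (m +
    -- 1)`.
    · rw [det_risingPow_eq_zero m d n hdm, Finset.prod_eq_zero (i := m + 1)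
        (s := Finset.Icc 1 (d - 1)) (by simp; omega), mul_zero, zero_mul]
      rw [Nat.cast_add, Nat.cast_one, sub_self, fibPoly_zero, mul_zero, zero_pow (by omega)]
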